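/- Let $d$ be a dimension, $\mathbb{T}^d=\mathbb{R}^d/\mathbb{Z}^d$ the torus with normalized Lebesgue measure, $\mathcal{S}(\mathbb{T}^d)$ the Fréchet space of smooth real functions on $\mathbb{T}^d$, and $\mathcal{S}'(\mathbb{T}^d)$ its topological dual, equipped with the $\sigma$-field generated by the maps $u\mapsto\langle u,\varphi\rangle$, $\varphi\in\mathcal{S}(\mathbb{T}^d)$. A *Lévy exponent* is a continuous function $f:\mathbb{R}\to\mathbb{C}$ with $f(0)=0$ such that $e^{f}$ is the characteristic function of an infinitely divisible probability law on $\mathbb{R}$. A *periodic Lévy white noise* is a measurable map $w$ from a probability space $(\Omega,\mathcal{F},\mathscr{P})$ to $\mathcal{S}'(\mathbb{T}^d)$ for which there is a Lévy exponent $f$ such that $$\mathbb{E}\big[e^{\mathrm{i}\langle w,\varphi\rangle}\big]=\exp\Big(\int_{\mathbb{T}^d} f(\varphi(\mathbf{r}))\,\mathrm{d}\mathbf{r}\Big)\qquad\text{for all }\varphi\in\mathcal{S}(\mathbb{T}^d).$$ For $\tau\in\mathbb{R}$ and $0<p,q\le\infty$, the *Besov space* $B^{\tau}_{p,q}(\mathbb{T}^d)$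 is the set of all $u\in\mathcal{S}'(\mathbb{T}^d)$ with $$\Big(\sum_{j=0}^{\infty}2^{j\tau q}\,\Big\|\sum_{n\in\mathbb{Z}^d}\chi_j(n)\,\langle u,e^{-2\pi\mathrm{i}\langle n,\cdot\rangle}\rangle\,e^{2\pi\mathrm{i}\langle n,\cdot\rangle}\Big\|_{L_p(\mathbb{T}^d)}^{q}\Big)^{1/q}<\infty$$ (supremum over $j$ if $q=\infty$), where $\chi_0\in C^\infty(\mathbb{R}^d)$ is real with $\chi_0(x)=1$ for $|x|\le1$ and $\chi_0(x)=0$ for $|x|\ge 3/2$, and $\chi_j(x)=\chi_0(2^{-j}x)-\chi_0(2^{-j+1}x)$ for $j\ge1$; the space does not depend on the choice of $\chi_0$. Let $w$ be a periodic Lévy white noise on $\mathbb{T}^d$. Then, for all $0<p,q\le\infty$ and all $\tau\in\mathbb{R}$ with $$\tau<d\Big(\frac{1}{\max(p,2)}-1\Big)$$ (where $1/\infty=0$), one has $w\in B^{\tau}_{p,q}(\mathbb{T}^d)$ almost surely. -/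

import Mathlib

open MeasureTheory
open scoped ENNReal

namespace PeriodicNoise

noncomputable section

/-! ### Test functions and generalized functions on the torus `𝕋^d = ℝ^d / ℤ^d` -/

/-- The quotient map `ℝ^d → 𝕋^d = ℝ^d / ℤ^d`. -/
def toTorus (d : ℕ) (x : Fin d → ℝ) : UnitAddTorus (Fin d) := fun i => (x i : UnitAddCircle)

/-- The space of smooth real functions on the torus, as a linear subspace of all functions: a
function is smooth when the periodic function on `ℝ^d` that it induces is `C^∞`. -/
def smoothTorus (d : ℕ) : Submodule ℝ (UnitAddTorus (Fin d) → ℝ) where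
  carrier := {φ | ContDiff ℝ ((⊤ : ℕ∞) : WithTop ℕ∞) (fun x : Fin d → ℝ => φ (toTorus d x))}
  zero_mem' := by
    simp only [Set.mem_ofPred_eq]
    exact contDiff_const
  add_mem' := fun {f g} hf hg => by
    simp only [Set.mem_ofPred_eq] at hf hg
    exact hf.add hg
  smul_mem' := fun c f hf => by
    simp only [Set.mem_ofPred_eq] at hf
    exact hf.const_smul c

/-- The space `𝓢(𝕋^d)` of smooth real functions on the torus. (It is a type of its own, so that it
does not inherit the topology of pointwise convergence.) -/
def TestFunction (d : ℕ) : Type := ↥(smoothTorus d)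

instance (d : ℕ) : AddCommGroup (TestFunction d) := inferInstanceAs (AddCommGroup (smoothTorus d))

instance (d : ℕ) : Module ℝ (TestFunction d) := inferInstanceAs (Module ℝ (smoothTorus d))

instance (d : ℕ) : CoeFun (TestFunction d) (fun _ => UnitAddTorus (Fin d) → ℝ) := ⟨fun φ => φ.1⟩

/-- The `ℤ^d`-periodic function on `ℝ^d` induced by a test function. -/
def TestFunction.lift {d : ℕ} (φ : TestFunction d) (x : Fin d → ℝ) : ℝ := φ (toTorus d x)

theorem TestFunction.contDiff_lift {d : ℕ} (φ : TestFunction d) :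
    ContDiff ℝ ((⊤ : ℕ∞) : WithTop ℕ∞) φ.lift := φ.2

theorem TestFunction.lift_add_int {d : ℕ} (φ : TestFunction d) (x : Fin d → ℝ) (m : Fin d → ℤ) :
    φ.lift (x + fun i => (m i : ℝ)) = φ.lift x := by
  have h : toTorus d (x + fun i => (m i : ℝ)) = toTorus d x := by
    funext i
    have h0 : (((m i : ℝ)) : UnitAddCircle) = 0 :=
      (AddCircle.coe_eq_zero_iff (1 : ℝ)).2 ⟨m i, by simp⟩
    simp only [toTorus, Pi.add_apply]
    rw [AddCircle.coe_add, h0, add_zero]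
  simp only [TestFunction.lift, h]

/-- All derivatives of a test function are bounded. -/
theorem TestFunction.bddAbove {d : ℕ} (k : ℕ) (φ : TestFunction d) :
    BddAbove (Set.range fun x => ‖iteratedFDeriv ℝ k φ.lift x‖) := by
  have hcont : Continuous fun x => ‖iteratedFDeriv ℝ k φ.lift x‖ :=
    (φ.contDiff_lift.continuous_iteratedFDeriv (by exact_mod_cast le_top)).norm
  obtain ⟨C, hC⟩ := (isCompact_Icc (a := (0 : Fin d → ℝ)) (b := 1)).bddAbove_image
    hcont.continuousOn
  refine ⟨C, ?_⟩
  rintro _ ⟨x, rfl⟩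
  have hper : iteratedFDeriv ℝ k φ.lift x
      = iteratedFDeriv ℝ k φ.lift (x + fun i => ((-⌊x i⌋ : ℤ) : ℝ)) := by
    have h1 : (fun z => φ.lift (z + fun i => ((-⌊x i⌋ : ℤ) : ℝ))) = φ.lift :=
      funext fun z => φ.lift_add_int z _
    have h2 := iteratedFDeriv_comp_add_right (𝕜 := ℝ) (f := φ.lift) k
      (fun i => ((-⌊x i⌋ : ℤ) : ℝ))
    rw [h1] at h2
    exact h2 x
  refine hC ⟨x + fun i => ((-⌊x i⌋ : ℤ) : ℝ), ⟨?_, ?_⟩, ?_⟩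
  · intro i
    simpa using Int.floor_le (x i)
  · intro i
    have := (Int.lt_floor_add_one (x i)).le
    simp only [Pi.add_apply, Pi.one_apply, Int.cast_neg]
    linarith
  · simp only [← hper]

/-- The seminorm `φ ↦ sup_x ‖D^k φ(x)‖` on `𝓢(𝕋^d)`. -/
def derivSeminorm (d : ℕ) : SeminormFamily ℝ (TestFunction d) ℕ := fun k =>
  Seminorm.of (fun φ => ⨆ x, ‖iteratedFDeriv ℝ k φ.lift x‖)
    (by
      intro φ ψ
      refine ciSup_le fun x => ?_
      have h : iteratedFDeriv ℝ k (φ + ψ).lift x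
          = iteratedFDeriv ℝ k φ.lift x + iteratedFDeriv ℝ k ψ.lift x :=
        iteratedFDeriv_add_apply
          ((φ.contDiff_lift.of_le (by exact_mod_cast le_top)).contDiffAt)
          ((ψ.contDiff_lift.of_le (by exact_mod_cast le_top)).contDiffAt)
      rw [h]
      exact (norm_add_le _ _).trans
        (add_le_add (le_ciSup (φ.bddAbove k) x) (le_ciSup (ψ.bddAbove k) x)))
    (by
      intro c φ
      have h : ∀ x, ‖iteratedFDeriv ℝ k (c • φ).lift x‖
          = ‖c‖ * ‖iteratedFDeriv ℝ k φ.lift x‖ := by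
        intro x
        have h1 : iteratedFDeriv ℝ k (c • φ).lift x = c • iteratedFDeriv ℝ k φ.lift x :=
          iteratedFDeriv_const_smul_apply
            ((φ.contDiff_lift.of_le (by exact_mod_cast le_top)).contDiffAt)
        rw [h1, norm_smul]
      simp only [h]
      exact (Real.mul_iSup_of_nonneg (norm_nonneg c) _).symm)

/-- The usual Fréchet topology of `𝓢(𝕋^d)`: uniform convergence of all derivatives. -/
instance (d : ℕ) : TopologicalSpace (TestFunction d) :=
  (derivSeminorm d).moduleFilterBasis.topology

/-- The space `𝓢'(𝕋^d)` of (real) generalized functions on the torus: the topological dual of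
`𝓢(𝕋^d)`. -/
abbrev PeriodicDistribution (d : ℕ) : Type := TestFunction d →L[ℝ] ℝ

/-- The cylindrical `σ`-field of `𝓢'(𝕋^d)`: it is generated by the maps `u ↦ ⟨u, φ⟩`. -/
instance (d : ℕ) : MeasurableSpace (PeriodicDistribution d) :=
  ⨆ φ : TestFunction d, MeasurableSpace.comap (fun u : PeriodicDistribution d => u φ) (borel ℝ)

/-- The normalized Lebesgue (Haar) measure on the torus. -/
def torusMeasure (d : ℕ) : Measure (UnitAddTorus (Fin d)) :=
  Measure.pi fun _ => AddCircle.haarAddCircle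

/-! ### Periodic Lévy white noises -/

/-- A probability measure on `ℝ` is infinitely divisible if, for every `n ≥ 1`, it is the law of
the sum of `n` independent identically distributed random variables. -/
def IsInfinitelyDivisible (ν : Measure ℝ) : Prop :=
  ∀ n : ℕ, 1 ≤ n → ∃ ρ : Measure ℝ, IsProbabilityMeasure ρ ∧
    (Measure.pi fun _ : Fin n => ρ).map (fun x => ∑ i, x i) = ν

/-- A Lévy exponent is the log-characteristic function of an infinitely divisible law, that is,
the continuous function `f` with `f(0) = 0` and `e^f` equal to the characteristic function. -/
def IsLevyExponent (f : ℝ → ℂ) : Prop :=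
  Continuous f ∧ f 0 = 0 ∧ ∃ ν : Measure ℝ, IsProbabilityMeasure ν ∧ IsInfinitelyDivisible ν ∧
    ∀ ξ : ℝ, charFun ν ξ = Complex.exp (f ξ)

/-- The characteristic functional `φ ↦ ∫ e^{i⟨u, φ⟩} dP(u)` of a law `P` on `𝓢'(𝕋^d)`. -/
def charFunctional {d : ℕ} (P : Measure (PeriodicDistribution d)) (φ : TestFunction d) : ℂ :=
  ∫ u, Complex.exp (Complex.I * ((u φ : ℝ) : ℂ)) ∂P

/-- `w` is a periodic Lévy white noise on the probability space `(Ω, P)`: a generalized periodic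
process whose characteristic functional is `φ ↦ exp (∫_{𝕋^d} f(φ(r)) dr)` with `f` a Lévy
exponent. -/
def IsPeriodicLevyWhiteNoise {Ω : Type*} [MeasurableSpace Ω] {d : ℕ} (P : Measure Ω)
    (w : Ω → PeriodicDistribution d) : Prop :=
  Measurable w ∧ ∃ f : ℝ → ℂ, IsLevyExponent f ∧ ∀ φ : TestFunction d,
    charFunctional (P.map w) φ = Complex.exp (∫ r, f (φ r) ∂(torusMeasure d))

/-! ### Besov spaces on the torus -/

theorem contDiff_mFourier_toTorus {d : ℕ} (n : Fin d → ℤ) :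
    ContDiff ℝ ((⊤ : ℕ∞) : WithTop ℕ∞)
      (fun x : Fin d → ℝ => UnitAddTorus.mFourier n (toTorus d x)) := by
  simp only [UnitAddTorus.mFourier, ContinuousMap.coe_mk, toTorus, fourier_coe_apply]
  refine contDiff_prod fun i _ => ?_
  have h : ContDiff ℝ ((⊤ : ℕ∞) : WithTop ℕ∞) (fun x : Fin d → ℝ => ((x i : ℝ) : ℂ)) :=
    Complex.ofRealCLM.contDiff.comp (contDiff_apply ℝ ℝ i)
  fun_prop

/-- The real part `cos (2π ⟨n, ·⟩)` of the exponential `e^{2πi⟨n, ·⟩}`. -/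
def cosTest {d : ℕ} (n : Fin d → ℤ) : TestFunction d :=
  ⟨fun x => (UnitAddTorus.mFourier n x).re,
    Complex.reCLM.contDiff.comp (contDiff_mFourier_toTorus n)⟩

/-- The imaginary part `sin (2π ⟨n, ·⟩)` of the exponential `e^{2πi⟨n, ·⟩}`. -/
def sinTest {d : ℕ} (n : Fin d → ℤ) : TestFunction d :=
  ⟨fun x => (UnitAddTorus.mFourier n x).im,
    Complex.imCLM.contDiff.comp (contDiff_mFourier_toTorus n)⟩

/-- The Fourier coefficient `⟨u, e^{-2πi⟨n, ·⟩}⟩` of a generalized function (the duality product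
being extended to complex test functions by linearity). -/
def fourierCoeffDist {d : ℕ} (u : PeriodicDistribution d) (n : Fin d → ℤ) : ℂ :=
  ((u (cosTest n) : ℝ) : ℂ) - Complex.I * ((u (sinTest n) : ℝ) : ℂ)

/-- A generator of a smooth dyadic resolution of unity of the frequency space `ℝ^d`. -/
structure DyadicGenerator (d : ℕ) where
  toFun : EuclideanSpace ℝ (Fin d) → ℝ
  smooth : ContDiff ℝ ((⊤ : ℕ∞) : WithTop ℕ∞) toFun
  eq_one : ∀ x, ‖x‖ ≤ 1 → toFun x = 1
  eq_zero : ∀ x, 3 / 2 ≤ ‖x‖ → toFun x = 0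

/-- Such generators exist. -/
instance (d : ℕ) : Nonempty (DyadicGenerator d) := by
  let b : ContDiffBump (0 : EuclideanSpace ℝ (Fin d)) := ⟨1, 3 / 2, by norm_num, by norm_num⟩
  refine ⟨⟨b, b.contDiff, fun x hx => b.one_of_mem_closedBall (by simpa using hx),
    fun x hx => b.zero_of_le_dist (by simpa using hx)⟩⟩

/-- The dyadic resolution of unity `(χ_j)_{j ≥ 0}` generated by `χ`: `χ_0 = χ` and
`χ_j(x) = χ(2^{-j} x) - χ(2^{-j+1} x)` for `j ≥ 1`. -/
def DyadicGenerator.piece {d : ℕ} (χ : DyadicGenerator d) :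
    ℕ → EuclideanSpace ℝ (Fin d) → ℝ
  | 0, x => χ.toFun x
  | j + 1, x => χ.toFun (((2 : ℝ) ^ (j + 1))⁻¹ • x) - χ.toFun (((2 : ℝ) ^ j)⁻¹ • x)

/-- The `j`-th dyadic block `∑_{n ∈ ℤ^d} χ_j(n) ⟨u, e^{-2πi⟨n, ·⟩}⟩ e^{2πi⟨n, ·⟩}` of a generalized
function; the sum has only finitely many nonzero terms. -/
def dyadicBlock {d : ℕ} (χ : DyadicGenerator d) (u : PeriodicDistribution d) (j : ℕ)
    (x : UnitAddTorus (Fin d)) : ℂ :=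
  ∑' n : Fin d → ℤ, ((χ.piece j (WithLp.toLp 2 fun i => (n i : ℝ)) : ℝ) : ℂ) *
    fourierCoeffDist u n * UnitAddTorus.mFourier n x

/-- The Besov (quasi-)norm `(∑_j 2^{jτq} ‖u_j‖_{L_p}^q)^{1/q}` of `u`, with the supremum over `j` if
`q = ∞`; here `u_j` are the dyadic blocks of `u`. -/
def besovNorm {d : ℕ} (χ : DyadicGenerator d) (τ : ℝ) (p q : ℝ≥0∞)
    (u : PeriodicDistribution d) : ℝ≥0∞ :=
  if q = ⊤ then
    ⨆ j : ℕ, (2 : ℝ≥0∞) ^ ((j : ℝ) * τ) * eLpNorm (dyadicBlock χ u j) p (torusMeasure d)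
  else
    (∑' j : ℕ, ((2 : ℝ≥0∞) ^ ((j : ℝ) * τ) *
      eLpNorm (dyadicBlock χ u j) p (torusMeasure d)) ^ q.toReal) ^ (1 / q.toReal)

/-- The Besov space `B^τ_{p,q}(𝕋^d)` of generalized functions of finite Besov (quasi-)norm. For
`p, q > 0` different generators have equivalent norms; finiteness is required for all of them. -/
def besovSpace (d : ℕ) (τ : ℝ) (p q : ℝ≥0∞) : Set (PeriodicDistribution d) :=
  {u | ∀ χ : DyadicGenerator d, besovNorm χ τ p q u < ⊤}

end

end PeriodicNoise

namespace PeriodicNoise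

open Filter Topology ProbabilityTheory

/-! ### Growth of Lévy exponents -/

/-! The noise may have no moments at all, so sizes are controlled in probability. A Lévy exponent
satisfies, for every `δ > 0`, a bound `‖f ξ‖ ≤ δ + C ξ²` (`IsLevyExponent.norm_le_add_mul_sq`). This
comes from trigonometric inequalities comparing `ξ` with `2ξ`, applied to the `n`-th convolution
roots of the law and passed to the limit `n → ∞`.

For test functions `e_k`, averaging the characteristic function of `(⟨w, e_k⟩)` over independent
standard Gaussian coefficients gives `E exp(-∑ ⟨w, e_k⟩² / 2)`. The same average removes the cross
terms of `∫ (∑ g_k e_k)²`. Hence `P(∑ ⟨w, e_k⟩² ≥ 2) ≤ 2 (δ + C A)` whenever `∑ e_k² ≤ A` pointwise,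
however many `e_k` there are (`measureReal_two_le_sum_sq_testFunction_le`).

Take the `e_k` to be sines and cosines with weights `√t 2^{js}` on dyadic frequency boxes. Since
`cos² + sin² = 1` and level `j` has `O(2^{jd})` frequencies, `A = O(t)` uniformly in the number of
levels as soon as `s < -d/2`. Choosing `δ`, then `t`, small gives almost sure Sobolev regularity of
every order `s < -d/2` (`ae_exists_sum_norm_fourierCoeffDist_sq_le`).

The rest is deterministic: for `p > 2`, interpolating each block between `L_2` and `L_∞` costs `d
(1/2 - 1/p)` derivatives; for `p ≤ 2` nothing is lost. The strict inequality left over gives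
geometric decay in `j`, hence every `q`. -/

theorem charFun_map_pi_sum (ρ : Measure ℝ) [IsProbabilityMeasure ρ] (n : ℕ) (ξ : ℝ) :
    charFun ((Measure.pi fun _ : Fin n => ρ).map (fun x => ∑ i, x i)) ξ = charFun ρ ξ ^ n := by
  rw [charFun_apply_real, integral_map (by fun_prop) (by fun_prop)]
  have h : ∀ x : Fin n → ℝ, Complex.exp (ξ * ((∑ i, x i : ℝ) : ℂ) * Complex.I)
      = ∏ i, Complex.exp (ξ * (x i) * Complex.I) := by
    intro x
    rw [← Complex.exp_sum]
    push_cast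
    rw [Finset.mul_sum, Finset.sum_mul]
  simp_rw [h]
  rw [integral_fintype_prod_eq_prod (𝕜 := ℂ) (fun _ : Fin n => fun y : ℝ =>
    Complex.exp (ξ * y * Complex.I))]
  simp [charFun_apply_real]

/-- A continuous function on `ℝ` all of whose values are `n`-th roots of unity is constant; here it
is `1` at the origin. -/
theorem eq_one_of_continuous_of_pow_eq_one {g : ℝ → ℂ} (hg : Continuous g) {n : ℕ} (hn : 1 ≤ n)
    (h : ∀ x, g x ^ n = 1) (h0 : g 0 = 1) (x : ℝ) : g x = 1 := by
  have hfin : {z : ℂ | z ^ n = 1}.Finite := by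
    refine ((Polynomial.nthRoots n (1 : ℂ)).toFinset.finite_toSet).subset fun z hz => ?_
    simpa [Polynomial.mem_nthRoots (show 0 < n by omega)] using hz
  rw [← h0]
  exact isPreconnected_univ.constant_of_mapsTo hfin.isDiscrete hg.continuousOn
    (fun y _ => h y) (Set.mem_univ x) (Set.mem_univ 0)

/-- The characteristic function of an `n`-th convolution root and `exp (f / n)` have the same `n`-th
power. Their quotient is continuous, takes values in the `n`-th roots of unity and is `1` at `0`, so
connectedness of `ℝ` selects the right branch. -/
theorem IsLevyExponent.exists_charFun_eq_exp_div {f : ℝ → ℂ} (hf : IsLevyExponent f) {n : ℕ}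
    (hn : 1 ≤ n) : ∃ ρ : Measure ℝ, IsProbabilityMeasure ρ ∧
      ∀ ξ, charFun ρ ξ = Complex.exp (f ξ / n) := by
  obtain ⟨hc, h0, ν, hν, hdiv, hchar⟩ := hf
  obtain ⟨ρ, hρ, hρν⟩ := hdiv n hn
  have hn0 : (n : ℂ) ≠ 0 := by exact_mod_cast (show n ≠ 0 by omega)
  refine ⟨ρ, hρ, fun ξ => ?_⟩
  have key := eq_one_of_continuous_of_pow_eq_one
    (g := fun ξ => charFun ρ ξ * Complex.exp (-(f ξ / n)))
    (continuous_charFun.mul (by fun_prop)) hn (fun ξ => by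
      rw [mul_pow, ← charFun_map_pi_sum, hρν, hchar, ← Complex.exp_nat_mul, ← Complex.exp_add]
      rw [mul_neg, mul_div_cancel₀ _ hn0, add_neg_cancel, Complex.exp_zero]) (by simp [h0]) ξ
  rw [Complex.exp_neg, ← div_eq_mul_inv, div_eq_one_iff_eq (Complex.exp_ne_zero _)] at key
  exact key

theorem re_charFun (ρ : Measure ℝ) [IsProbabilityMeasure ρ] (ξ : ℝ) :
    (charFun ρ ξ).re = ∫ x, Real.cos (ξ * x) ∂ρ := by
  rw [charFun_apply_real, ← RCLike.re_eq_complex_re, ← integral_re]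
  · refine integral_congr_ae (ae_of_all _ fun x => ?_)
    simp only [RCLike.re_eq_complex_re]
    rw [← Complex.ofReal_mul, Complex.exp_ofReal_mul_I_re]
  · refine Integrable.of_bound (C := 1) (by fun_prop) (ae_of_all _ fun x => ?_)
    rw [← Complex.ofReal_mul, Complex.norm_exp_ofReal_mul_I]

theorem im_charFun (ρ : Measure ℝ) [IsProbabilityMeasure ρ] (ξ : ℝ) :
    (charFun ρ ξ).im = ∫ x, Real.sin (ξ * x) ∂ρ := by
  rw [charFun_apply_real, ← RCLike.im_eq_complex_im, ← integral_im]
  · refine integral_congr_ae (ae_of_all _ fun x => ?_)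
    simp only [RCLike.im_eq_complex_im]
    rw [← Complex.ofReal_mul, Complex.exp_ofReal_mul_I_im]
  · refine Integrable.of_bound (C := 1) (by fun_prop) (ae_of_all _ fun x => ?_)
    rw [← Complex.ofReal_mul, Complex.norm_exp_ofReal_mul_I]

theorem integrable_cos_mul (ρ : Measure ℝ) [IsProbabilityMeasure ρ] (ξ : ℝ) :
    Integrable (fun x => Real.cos (ξ * x)) ρ :=
  Integrable.of_bound (C := 1) (by fun_prop) (ae_of_all _ fun _ => Real.abs_cos_le_one _)

theorem integrable_sin_mul (ρ : Measure ℝ) [IsProbabilityMeasure ρ] (ξ : ℝ) :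
    Integrable (fun x => Real.sin (ξ * x)) ρ :=
  Integrable.of_bound (C := 1) (by fun_prop) (ae_of_all _ fun _ => Real.abs_sin_le_one _)

theorem one_sub_re_charFun_eq (ρ : Measure ℝ) [IsProbabilityMeasure ρ] (ξ : ℝ) :
    1 - (charFun ρ ξ).re = ∫ x, (1 - Real.cos (ξ * x)) ∂ρ := by
  rw [re_charFun, integral_sub (integrable_const _) (integrable_cos_mul ρ ξ)]
  simp

/-- Integrate `4 (1 - cos θ) - (1 - cos 2θ) = 2 (1 - cos θ)² ≥ 0`. -/
theorem one_sub_re_charFun_two_mul_le (ρ : Measure ℝ) [IsProbabilityMeasure ρ] (ξ : ℝ) :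
    1 - (charFun ρ (2 * ξ)).re ≤ 4 * (1 - (charFun ρ ξ).re) := by
  rw [one_sub_re_charFun_eq, one_sub_re_charFun_eq, ← integral_const_mul]
  refine integral_mono ((integrable_const _).sub (integrable_cos_mul ρ _))
    (((integrable_const _).sub (integrable_cos_mul ρ _)).const_mul _) fun x => ?_
  simp only
  rw [mul_assoc, Real.cos_two_mul]
  nlinarith [sq_nonneg (Real.cos (ξ * x) - 1)]

/-- Integrate `sin 2θ - 2 sin θ = -2 sin θ (1 - cos θ)`, using `|sin θ| ≤ 1`. -/
theorem abs_im_charFun_two_mul_sub_le (ρ : Measure ℝ) [IsProbabilityMeasure ρ] (ξ : ℝ) :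
    |(charFun ρ (2 * ξ)).im - 2 * (charFun ρ ξ).im| ≤ 2 * (1 - (charFun ρ ξ).re) := by
  rw [im_charFun, im_charFun, one_sub_re_charFun_eq, ← integral_const_mul, ← integral_const_mul,
    ← integral_sub (integrable_sin_mul ρ _) ((integrable_sin_mul ρ _).const_mul _)]
  refine abs_integral_le_integral_abs.trans (integral_mono
    ((integrable_sin_mul ρ _).sub ((integrable_sin_mul ρ _).const_mul _)).abs
    (((integrable_const _).sub (integrable_cos_mul ρ _)).const_mul _) fun x => ?_)
  simp only
  rw [mul_assoc, Real.sin_two_mul]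
  have h1 : 2 * Real.sin (ξ * x) * Real.cos (ξ * x) - 2 * Real.sin (ξ * x)
      = -(2 * (Real.sin (ξ * x) * (1 - Real.cos (ξ * x)))) := by ring
  have h2 : 0 ≤ 1 - Real.cos (ξ * x) := by linarith [Real.cos_le_one (ξ * x)]
  rw [h1, abs_neg, abs_mul, abs_mul, abs_of_nonneg h2, abs_two]
  nlinarith [Real.abs_sin_le_one (ξ * x)]

/-- This is the derivative of `t ↦ exp (t z)` at `0` along `t = 1 / (n + 1)`. It recovers `-f` from
the convolution roots, so inequalities homogeneous in `1 - charFun` pass to `-f`. -/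
theorem tendsto_mul_one_sub_exp_div (z : ℂ) :
    Tendsto (fun n : ℕ => ((n + 1 : ℕ) : ℂ) * (1 - Complex.exp (z / ((n + 1 : ℕ) : ℂ))))
      atTop (𝓝 (-z)) := by
  have h : HasDerivAt (fun t : ℝ => Complex.exp (t * z)) z 0 := by
    have h1 : HasDerivAt (fun t : ℝ => (t : ℂ) * z) (1 * z) 0 :=
      (Complex.ofRealCLM.hasDerivAt (x := (0 : ℝ))).mul_const z
    simpa using h1.cexp
  have h2 := h.tendsto_slope_zero
  have h3 : Tendsto (fun n : ℕ => 1 / ((n : ℝ) + 1)) atTop (𝓝[≠] 0) :=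
    tendsto_nhdsWithin_iff.2 ⟨tendsto_one_div_add_atTop_nhds_zero_nat,
      Eventually.of_forall fun n => by
        simp only [Set.mem_compl_iff, Set.mem_singleton_iff]
        positivity⟩
  refine ((h2.comp h3).neg).congr fun n => ?_
  simp only [Function.comp_apply, zero_add, Complex.ofReal_zero, zero_mul, Complex.exp_zero,
    Complex.real_smul]
  push_cast
  rw [one_div, inv_inv, ← mul_neg, neg_sub, div_eq_inv_mul]

theorem IsLevyExponent.re_nonpos {f : ℝ → ℂ} (hf : IsLevyExponent f) (ξ : ℝ) : (f ξ).re ≤ 0 := by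
  obtain ⟨-, -, ν, hν, -, hchar⟩ := hf
  have h := norm_charFun_le_one (μ := ν) ξ
  rwa [hchar, Complex.norm_exp, Real.exp_le_one_iff] at h

theorem IsLevyExponent.neg_re_two_mul_le {f : ℝ → ℂ} (hf : IsLevyExponent f) (ξ : ℝ) :
    -(f (2 * ξ)).re ≤ 4 * -(f ξ).re := by
  have h1 := (Complex.continuous_re.tendsto _).comp (tendsto_mul_one_sub_exp_div (f (2 * ξ)))
  have h2 := (Complex.continuous_re.tendsto _).comp (tendsto_mul_one_sub_exp_div (f ξ))
  refine le_of_tendsto_of_tendsto' h1 (h2.const_mul 4) fun n => ?_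
  obtain ⟨ρ, hρ, hchar⟩ := hf.exists_charFun_eq_exp_div (n := n + 1) (by omega)
  have h3 := one_sub_re_charFun_two_mul_le ρ ξ
  rw [hchar, hchar] at h3
  simp only [Function.comp_apply, Complex.mul_re, Complex.natCast_re, Complex.natCast_im, zero_mul,
    sub_zero, Complex.sub_re, Complex.one_re]
  have h4 : (0 : ℝ) ≤ ((n + 1 : ℕ) : ℝ) := Nat.cast_nonneg _
  nlinarith

theorem IsLevyExponent.abs_im_two_mul_sub_le {f : ℝ → ℂ} (hf : IsLevyExponent f) (ξ : ℝ) :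
    |(f (2 * ξ)).im - 2 * (f ξ).im| ≤ 2 * -(f ξ).re := by
  have h1 := (Complex.continuous_im.tendsto _).comp (tendsto_mul_one_sub_exp_div (f (2 * ξ)))
  have h2 := (Complex.continuous_im.tendsto _).comp (tendsto_mul_one_sub_exp_div (f ξ))
  have h3 := (Complex.continuous_re.tendsto _).comp (tendsto_mul_one_sub_exp_div (f ξ))
  have h4 : |(f (2 * ξ)).im - 2 * (f ξ).im| = |(-(f (2 * ξ))).im - 2 * (-(f ξ)).im| := by
    rw [← abs_neg]; congr 1; simp only [Complex.neg_im]; ring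
  rw [h4]
  refine le_of_tendsto_of_tendsto' (h1.sub (h2.const_mul 2)).abs (h3.const_mul 2) fun n => ?_
  obtain ⟨ρ, hρ, hchar⟩ := hf.exists_charFun_eq_exp_div (n := n + 1) (by omega)
  have h5 := abs_im_charFun_two_mul_sub_le ρ ξ
  rw [hchar, hchar] at h5
  simp only [Function.comp_apply, Complex.mul_im, Complex.mul_re, Complex.natCast_re,
    Complex.natCast_im, zero_mul, add_zero, sub_zero, Complex.sub_im, Complex.sub_re,
    Complex.one_re, Complex.one_im]
  have h6 : (0 : ℝ) ≤ ((n + 1 : ℕ) : ℝ) := Nat.cast_nonneg _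
  have h7 : ∀ a b c : ℝ, c * (0 - a) - 2 * (c * (0 - b)) = -((a - 2 * b) * c) := by intros; ring
  rw [h7, abs_neg, abs_mul, abs_of_nonneg h6]
  nlinarith

/-- A Lévy exponent is bounded by `δ` near the origin and grows at most quadratically. -/
theorem IsLevyExponent.norm_le_add_mul_sq {f : ℝ → ℂ} (hf : IsLevyExponent f) {δ : ℝ}
    (hδ : 0 < δ) :
    ∃ C : ℝ, 0 ≤ C ∧ ∀ ξ, ‖f ξ‖ ≤ δ + C * ξ ^ 2 := by
  obtain ⟨η, hη, hball⟩ := Metric.continuousAt_iff.1 (hf.1.continuousAt (x := 0)) (δ / 2)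
    (half_pos hδ)
  have base : ∀ ξ : ℝ, |ξ| < η → ‖f ξ‖ ≤ δ / 2 := fun ξ hξ => by
    have := hball (x := ξ) (by simpa using hξ)
    rw [hf.2.1, dist_zero_right] at this
    exact this.le
  -- Doubling `ξ` multiplies the bound by `4` for both parts: for the imaginary part, twice its own
  -- bound plus twice the bound on `-(f ξ).re`.
  have dbl : ∀ k : ℕ, ∀ ξ : ℝ, |ξ| < 2 ^ k * η →
      -(f ξ).re ≤ δ / 2 * 4 ^ k ∧ |(f ξ).im| ≤ δ / 2 * 4 ^ k := by
    intro k
    induction k with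
    | zero =>
      intro ξ hξ
      have h := base ξ (by simpa using hξ)
      refine ⟨?_, ?_⟩
      · have := (abs_le.1 (Complex.abs_re_le_norm (f ξ))).1
        linarith
      · simpa using (Complex.abs_im_le_norm _).trans h
    | succ k ih =>
      intro ξ hξ
      have hξ2 : |ξ / 2| < 2 ^ k * η := by
        rw [abs_div, abs_two, div_lt_iff₀ two_pos]
        calc |ξ| < 2 ^ (k + 1) * η := hξ
          _ = _ := by ring
      obtain ⟨h1, h2⟩ := ih _ hξ2
      have h3 := hf.neg_re_two_mul_le (ξ / 2)
      have h4 := hf.abs_im_two_mul_sub_le (ξ / 2)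
      have e : 2 * (ξ / 2) = ξ := by ring
      rw [e] at h3 h4
      refine ⟨by rw [pow_succ]; linarith, ?_⟩
      rw [abs_le] at h2 h4 ⊢
      rw [pow_succ]
      constructor <;> linarith [h2.1, h2.2, h4.1, h4.2]
  -- For `2^k η ≤ |ξ| < 2^{k+1} η` the two parts add up to at most `δ 4^{k+1}`, and `4^k ≤ ξ² / η²`.
  refine ⟨4 * δ / η ^ 2, by positivity, fun ξ => ?_⟩
  obtain hξ | hξ := lt_or_ge |ξ| η
  · have := base ξ hξ
    have h2 : 0 ≤ 4 * δ / η ^ 2 * ξ ^ 2 := by positivity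
    linarith
  · obtain ⟨k, hk1, hk2⟩ := exists_nat_pow_near (x := |ξ| / η) ((one_le_div hη).2 hξ)
      (one_lt_two : (1 : ℝ) < 2)
    rw [le_div_iff₀ hη] at hk1
    rw [div_lt_iff₀ hη] at hk2
    obtain ⟨h1, h2⟩ := dbl (k + 1) ξ hk2
    have h3 : ‖f ξ‖ ≤ |(f ξ).re| + |(f ξ).im| := Complex.norm_le_abs_re_add_abs_im _
    rw [abs_of_nonpos (hf.re_nonpos ξ)] at h3
    have h4 : (4 : ℝ) ^ (k + 1) = 4 * ((2 : ℝ) ^ k) ^ 2 := by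
      rw [← pow_mul, mul_comm k 2, pow_mul, pow_succ]; norm_num; ring
    have h5 : ((2 : ℝ) ^ k) ^ 2 ≤ ξ ^ 2 / η ^ 2 := by
      rw [le_div_iff₀ (by positivity), ← mul_pow, ← sq_abs ξ]
      exact pow_le_pow_left₀ (by positivity) hk1 2
    calc ‖f ξ‖ ≤ δ * (4 * ((2 : ℝ) ^ k) ^ 2) := by rw [h4] at h1 h2; linarith
      _ ≤ δ * (4 * (ξ ^ 2 / η ^ 2)) := by gcongr
      _ = 4 * δ / η ^ 2 * ξ ^ 2 := by ring
      _ ≤ _ := by linarith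

/-! ### A Gaussian averaging estimate -/

theorem integral_exp_sum_pi_gaussianReal {ι : Type*} [Fintype ι] (x : ι → ℝ) :
    ∫ g : ι → ℝ, Complex.exp (Complex.I * ((∑ k, g k * x k : ℝ) : ℂ))
        ∂(Measure.pi fun _ => gaussianReal 0 1)
      = ((Real.exp (-(∑ k, x k ^ 2) / 2) : ℝ) : ℂ) := by
  have h : ∀ g : ι → ℝ, Complex.exp (Complex.I * ((∑ k, g k * x k : ℝ) : ℂ))
      = ∏ k, Complex.exp ((x k : ℝ) * (g k) * Complex.I) := by
    intro g
    rw [← Complex.exp_sum]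
    push_cast
    rw [Finset.mul_sum]
    congr 1
    exact Finset.sum_congr rfl fun k _ => by ring
  simp_rw [h]
  rw [integral_fintype_prod_eq_prod (𝕜 := ℂ) (fun k : ι => fun y : ℝ =>
    Complex.exp ((x k : ℝ) * y * Complex.I))]
  simp_rw [← charFun_apply_real, charFun_gaussianReal]
  rw [← Complex.exp_sum]
  push_cast
  congr 1
  rw [neg_div, Finset.sum_div, ← Finset.sum_neg_distrib]
  exact Finset.sum_congr rfl fun k _ => by simp

theorem memLp_eval_pi_gaussianReal {ι : Type*} [Fintype ι] (k : ι) :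
    MemLp (fun g : ι → ℝ => g k) 2 (Measure.pi fun _ => gaussianReal 0 1) :=
  (memLp_id_gaussianReal (μ := 0) (v := 1) 2).comp_measurePreserving
    (measurePreserving_eval (fun _ : ι => gaussianReal 0 1) k)

theorem integral_eval_mul_eval_pi_gaussianReal {ι : Type*} [Fintype ι] [DecidableEq ι] (k l : ι) :
    ∫ g : ι → ℝ, g k * g l ∂(Measure.pi fun _ => gaussianReal 0 1) = if k = l then 1 else 0 := by
  have hmp := fun k => measurePreserving_eval (fun _ : ι => gaussianReal 0 1) k
  have hmean : ∀ k, ∫ g : ι → ℝ, g k ∂(Measure.pi fun _ => gaussianReal 0 1) = 0 := fun k => by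
    have h := integral_map (μ := Measure.pi fun _ : ι => gaussianReal 0 1)
      (hmp k).measurable.aemeasurable (f := fun y : ℝ => y) (by fun_prop)
    rw [(hmp k).map_eq, integral_id_gaussianReal] at h
    exact h.symm
  split_ifs with hkl
  · subst hkl
    have h := integral_map (μ := Measure.pi fun _ : ι => gaussianReal 0 1)
      (hmp k).measurable.aemeasurable (f := fun y : ℝ => y * y) (by fun_prop)
    rw [(hmp k).map_eq] at h
    refine h.symm.trans ?_
    have hv := variance_of_integral_eq_zero (X := fun y : ℝ => y) (μ := gaussianReal 0 1)
      (by fun_prop) integral_id_gaussianReal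
    rw [variance_fun_id_gaussianReal] at hv
    simpa [sq] using hv.symm
  · have hind : IndepFun (fun g : ι → ℝ => g k) (fun g : ι → ℝ => g l)
        (Measure.pi fun _ => gaussianReal 0 1) :=
      (iIndepFun_pi (X := fun _ : ι => (id : ℝ → ℝ)) (fun _ => aemeasurable_id)).indepFun hkl
    have h := hind.integral_mul_eq_mul_integral
      (measurable_pi_apply k).aestronglyMeasurable (measurable_pi_apply l).aestronglyMeasurable
    simp only [Pi.mul_apply] at h
    rw [h, hmean, zero_mul]

/-- If the characteristic function of `(X_k)` is close to `1` on Gaussian average, then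
`∑ X_k ^ 2` is small with large probability. -/
theorem measureReal_two_le_sum_sq_le {Ω ι : Type*} [MeasurableSpace Ω] [Fintype ι]
    (P : Measure Ω) [IsProbabilityMeasure P] {X : ι → Ω → ℝ} (hX : ∀ k, Measurable (X k))
    {Q : (ι → ℝ) → ℝ} (hQ : Integrable Q (Measure.pi fun _ => gaussianReal 0 1))
    (hXQ : ∀ g : ι → ℝ,
      ‖1 - ∫ ω, Complex.exp (Complex.I * ((∑ k, g k * X k ω : ℝ) : ℂ)) ∂P‖ ≤ Q g) :
    P.real {ω | 2 ≤ ∑ k, X k ω ^ 2}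
      ≤ 2 * ∫ g, Q g ∂(Measure.pi fun _ : ι => gaussianReal 0 1) := by
  set γ : Measure (ι → ℝ) := Measure.pi fun _ => gaussianReal 0 1 with hγ
  let F : Ω → (ι → ℝ) → ℂ := fun ω g => Complex.exp (Complex.I * ((∑ k, g k * X k ω : ℝ) : ℂ))
  have hint : Integrable (Function.uncurry F) (P.prod γ) := by
    refine Integrable.of_bound (C := 1) ?_ (ae_of_all _ fun z => ?_)
    · have h : Measurable fun z : Ω × (ι → ℝ) =>
          Complex.exp (Complex.I * ((∑ k, z.2 k * X k z.1 : ℝ) : ℂ)) := by fun_prop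
      exact h.aestronglyMeasurable
    · simp only [Function.uncurry, F]
      rw [mul_comm, Complex.norm_exp_ofReal_mul_I]
  have hSmeas : Measurable fun ω => ∑ k, X k ω ^ 2 := by fun_prop
  have hexp_le : ∀ ω, Real.exp (-(∑ k, X k ω ^ 2) / 2) ≤ 1 := fun ω => by
    rw [Real.exp_le_one_iff]
    have : 0 ≤ ∑ k, X k ω ^ 2 := Finset.sum_nonneg fun k _ => sq_nonneg _
    linarith
  have hexp_int : Integrable (fun ω => Real.exp (-(∑ k, X k ω ^ 2) / 2)) P :=
    Integrable.of_bound (C := 1) (by fun_prop) (ae_of_all _ fun ω => by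
      rw [Real.norm_eq_abs, abs_of_pos (Real.exp_pos _)]; exact hexp_le ω)
  -- Fubini: integrating over the Gaussian coefficients first turns the oscillating exponential into
  -- `exp (-∑ X_k² / 2)`.
  have hswap : ((∫ ω, Real.exp (-(∑ k, X k ω ^ 2) / 2) ∂P : ℝ) : ℂ)
      = ∫ g, ∫ ω, F ω g ∂P ∂γ := by
    have h := integral_integral_swap (f := F) hint
    rw [← h, ← integral_complex_ofReal]
    exact integral_congr_ae (ae_of_all _ fun ω =>
      (integral_exp_sum_pi_gaussianReal fun k => X k ω).symm)
  have hle : ∫ ω, (1 - Real.exp (-(∑ k, X k ω ^ 2) / 2)) ∂P ≤ ∫ g, Q g ∂γ := by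
    have h1 : ((∫ ω, (1 - Real.exp (-(∑ k, X k ω ^ 2) / 2)) ∂P : ℝ) : ℂ)
        = ∫ g, (1 - ∫ ω, F ω g ∂P) ∂γ := by
      rw [integral_sub (integrable_const _) hexp_int,
        integral_sub (integrable_const _) (show Integrable (fun g => ∫ ω, F ω g ∂P) γ from
          hint.integral_prod_right)]
      push_cast
      rw [hswap]
      simp
    calc ∫ ω, (1 - Real.exp (-(∑ k, X k ω ^ 2) / 2)) ∂P
        ≤ ‖((∫ ω, (1 - Real.exp (-(∑ k, X k ω ^ 2) / 2)) ∂P : ℝ) : ℂ)‖ := by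
          rw [Complex.norm_real]; exact le_abs_self _
      _ ≤ ∫ g, Q g ∂γ := by
          rw [h1]
          exact norm_integral_le_of_norm_le hQ (ae_of_all _ hXQ)
  -- Markov at level `1/2` suffices, since `∑ X_k² ≥ 2` forces `1 - exp (-∑ X_k² / 2) ≥ 1 - e⁻¹ >
  -- 1/2`.
  have hmarkov := mul_meas_ge_le_integral_of_nonneg (μ := P)
    (f := fun ω => 1 - Real.exp (-(∑ k, X k ω ^ 2) / 2))
    (ae_of_all _ fun ω => sub_nonneg.2 (hexp_le ω)) ((integrable_const _).sub hexp_int) (1 / 2)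
  have hsub : P.real {ω | 2 ≤ ∑ k, X k ω ^ 2}
      ≤ P.real {ω | 1 / 2 ≤ 1 - Real.exp (-(∑ k, X k ω ^ 2) / 2)} := by
    refine measureReal_mono fun ω hω => ?_
    simp only [Set.mem_ofPred_eq] at hω ⊢
    have h1 : Real.exp (-(∑ k, X k ω ^ 2) / 2) ≤ Real.exp (-1) :=
      Real.exp_le_exp.2 (by linarith)
    have h2 := Real.exp_neg_one_lt_d9
    linarith
  linarith

/-! ### Smallness in probability for white noises -/

theorem continuous_cosTest {d : ℕ} (n : Fin d → ℤ) : Continuous (cosTest n) :=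
  Complex.continuous_re.comp (UnitAddTorus.mFourier n).continuous

theorem continuous_sinTest {d : ℕ} (n : Fin d → ℤ) : Continuous (sinTest n) :=
  Complex.continuous_im.comp (UnitAddTorus.mFourier n).continuous

instance (d : ℕ) : IsProbabilityMeasure (torusMeasure d) := by
  unfold torusMeasure; infer_instance

theorem sum_apply_testFunction {d : ℕ} {ι : Type*} (s : Finset ι) (e : ι → TestFunction d)
    (x : UnitAddTorus (Fin d)) : (∑ k ∈ s, e k : TestFunction d) x = ∑ k ∈ s, e k x := by
  classical
  induction s using Finset.induction_on with
  | empty => simp; rfl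
  | insert a s ha ih => rw [Finset.sum_insert ha, Finset.sum_insert ha, ← ih]; rfl

/-- The half-plane `re ≤ 0` is convex and the derivative of `exp` has norm at most `1` there. -/
theorem norm_one_sub_exp_le {z : ℂ} (hz : z.re ≤ 0) : ‖1 - Complex.exp z‖ ≤ ‖z‖ := by
  have h := (convex_halfSpace_re_le (0 : ℝ)).norm_image_sub_le_of_norm_hasDerivWithin_le
    (f := Complex.exp) (f' := Complex.exp) (C := 1) (x := z) (y := 0)
    (fun w _ => (Complex.hasDerivAt_exp w).hasDerivWithinAt)
    (fun w hw => by rw [Complex.norm_exp, Real.exp_le_one_iff]; exact hw) hz (by simp)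
  simpa using h

theorem measurable_apply_testFunction {d : ℕ} (φ : TestFunction d) :
    Measurable fun u : PeriodicDistribution d => u φ := by
  rw [measurable_iff_comap_le, BorelSpace.measurable_eq (α := ℝ)]
  exact le_iSup (fun φ : TestFunction d =>
    MeasurableSpace.comap (fun u : PeriodicDistribution d => u φ) (borel ℝ)) φ

/-- The exponent `∫ f(φ)` has nonpositive real part, so the deviation from `1` is at most its norm;
`δ` integrates to `δ` because the torus has mass one. -/
theorem norm_one_sub_integral_exp_le {Ω : Type*} [MeasurableSpace Ω] {P : Measure Ω} {d : ℕ}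
    {w : Ω → PeriodicDistribution d} (hw : Measurable w) {f : ℝ → ℂ} (hf : IsLevyExponent f)
    (hchar : ∀ φ : TestFunction d,
      charFunctional (P.map w) φ = Complex.exp (∫ r, f (φ r) ∂(torusMeasure d)))
    {δ C : ℝ} (hfb : ∀ ξ, ‖f ξ‖ ≤ δ + C * ξ ^ 2) (φ : TestFunction d) (hφ : Continuous φ) :
    ‖1 - ∫ ω, Complex.exp (Complex.I * ((w ω φ : ℝ) : ℂ)) ∂P‖
      ≤ δ + C * ∫ r, φ r ^ 2 ∂(torusMeasure d) := by
  have h1 : ∫ ω, Complex.exp (Complex.I * ((w ω φ : ℝ) : ℂ)) ∂P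
      = Complex.exp (∫ r, f (φ r) ∂(torusMeasure d)) := by
    rw [← hchar, charFunctional, integral_map hw.aemeasurable]
    have h := Complex.measurable_ofReal.comp (measurable_apply_testFunction φ)
    exact (Complex.measurable_exp.comp (h.const_mul Complex.I)).aestronglyMeasurable
  have hint : Integrable (fun r => f (φ r)) (torusMeasure d) :=
    (hf.1.comp hφ).integrable_of_hasCompactSupport (HasCompactSupport.of_compactSpace _)
  have hsq : Integrable (fun r => φ r ^ 2) (torusMeasure d) :=
    (hφ.pow 2).integrable_of_hasCompactSupport (HasCompactSupport.of_compactSpace _)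
  rw [h1]
  refine (norm_one_sub_exp_le ?_).trans ?_
  · have h2 := integral_re hint
    simp only [RCLike.re_eq_complex_re] at h2
    rw [← h2]
    exact integral_nonpos fun r => hf.re_nonpos _
  · calc ‖∫ r, f (φ r) ∂(torusMeasure d)‖ ≤ ∫ r, (δ + C * φ r ^ 2) ∂(torusMeasure d) :=
          norm_integral_le_of_norm_le ((integrable_const _).add (hsq.const_mul _))
            (ae_of_all _ fun r => hfb _)
      _ = _ := by
          rw [integral_add (integrable_const _) (hsq.const_mul _), integral_const_mul]
          simp

/-- By linearity `∑ g_k ⟨w, e_k⟩ = ⟨w, ∑ g_k e_k⟩`, and `E[g_k g_l] = δ_{kl}` leaves only `∑ ∫ e_k²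
≤ A` from the quadratic term. The constant `δ` is not multiplied by the number of test functions,
which allows arbitrarily many frequencies. -/
theorem measureReal_two_le_sum_sq_testFunction_le {Ω : Type*} [MeasurableSpace Ω] {P : Measure Ω}
    [IsProbabilityMeasure P] {d : ℕ}
    {w : Ω → PeriodicDistribution d} (hw : Measurable w) {f : ℝ → ℂ} (hf : IsLevyExponent f)
    (hchar : ∀ φ : TestFunction d,
      charFunctional (P.map w) φ = Complex.exp (∫ r, f (φ r) ∂(torusMeasure d)))
    {δ C : ℝ} (hC : 0 ≤ C) (hfb : ∀ ξ, ‖f ξ‖ ≤ δ + C * ξ ^ 2)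
    {ι : Type*} [Fintype ι] (e : ι → TestFunction d) (he : ∀ k, Continuous (e k))
    {A : ℝ} (hA : ∀ r, ∑ k, e k r ^ 2 ≤ A) :
    P.real {ω | 2 ≤ ∑ k, w ω (e k) ^ 2} ≤ 2 * (δ + C * A) := by
  classical
  have hij : ∀ k l, Integrable (fun r => e k r * e l r) (torusMeasure d) := fun k l =>
    ((he k).mul (he l)).integrable_of_hasCompactSupport (HasCompactSupport.of_compactSpace _)
  set M : ι → ι → ℝ := fun k l => ∫ r, e k r * e l r ∂(torusMeasure d) with hM
  have hgint : ∀ k l : ι, Integrable (fun g : ι → ℝ => g k * g l * M k l)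
      (Measure.pi fun _ => gaussianReal 0 1) := fun k l =>
    ((memLp_eval_pi_gaussianReal k).integrable_mul (memLp_eval_pi_gaussianReal l)).mul_const _
  have hsumint : Integrable (fun g : ι → ℝ => ∑ k, ∑ l, g k * g l * M k l)
      (Measure.pi fun _ => gaussianReal 0 1) :=
    integrable_finsetSum _ fun k _ => integrable_finsetSum _ fun l _ => hgint k l
  refine (measureReal_two_le_sum_sq_le P (X := fun k ω => w ω (e k))
    (fun k => (measurable_apply_testFunction (e k)).comp hw)
    (Q := fun g => δ + C * ∑ k, ∑ l, g k * g l * M k l)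
    ((integrable_const _).add (hsumint.const_mul _)) fun g => ?_).trans ?_
  · have hval : ∀ r, (∑ k, g k • e k : TestFunction d) r = ∑ k, g k * e k r := fun r => by
      rw [sum_apply_testFunction]; rfl
    have hcont : Continuous (∑ k, g k • e k : TestFunction d) := by
      rw [show ((∑ k, g k • e k : TestFunction d) : UnitAddTorus (Fin d) → ℝ)
        = fun r => ∑ k, g k * e k r from funext hval]
      exact continuous_finsetSum _ fun k _ => (he k).const_mul _
    have h := norm_one_sub_integral_exp_le hw hf hchar hfb (∑ k, g k • e k) hcont
    have hlin : ∀ ω, w ω (∑ k, g k • e k) = ∑ k, g k * w ω (e k) := fun ω => by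
      simp [map_sum]
    simp_rw [hlin] at h
    refine h.trans_eq ?_
    congr 2
    simp_rw [hval]
    calc ∫ r, (∑ k, g k * e k r) ^ 2 ∂(torusMeasure d)
        = ∫ r, ∑ k, ∑ l, g k * g l * (e k r * e l r) ∂(torusMeasure d) := by
          refine integral_congr_ae (ae_of_all _ fun r => ?_)
          simp only [sq, Finset.sum_mul_sum]
          exact Finset.sum_congr rfl fun k _ => Finset.sum_congr rfl fun l _ => by ring
      _ = _ := by
          rw [integral_finsetSum _ fun k _ =>
            integrable_finsetSum _ fun l _ => (hij k l).const_mul _]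
          refine Finset.sum_congr rfl fun k _ => ?_
          rw [integral_finsetSum _ fun l _ => (hij k l).const_mul _]
          exact Finset.sum_congr rfl fun l _ => integral_const_mul _ _
  · rw [integral_add (integrable_const _) (hsumint.const_mul _), integral_const_mul,
      integral_finsetSum _ fun k _ => integrable_finsetSum _ fun l _ => hgint k l]
    have h1 : ∀ k, ∫ g : ι → ℝ, ∑ l, g k * g l * M k l ∂(Measure.pi fun _ => gaussianReal 0 1)
        = M k k := fun k => by
      rw [integral_finsetSum _ fun l _ => hgint k l]
      simp_rw [integral_mul_const, integral_eval_mul_eval_pi_gaussianReal]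
      simp
    simp_rw [h1]
    have h2 : ∑ k, M k k ≤ A := by
      rw [hM, ← integral_finsetSum _ fun k _ => hij k k]
      calc ∫ r, ∑ k, e k r * e k r ∂(torusMeasure d) ≤ ∫ _, A ∂(torusMeasure d) :=
            integral_mono (integrable_finsetSum _ fun k _ => hij k k) (integrable_const _)
              fun r => by simpa [sq] using hA r
        _ = A := by simp
    have h3 := mul_le_mul_of_nonneg_left h2 hC
    simp only [integral_const, probReal_univ, one_smul]
    linarith

/-! ### Almost sure growth of the Fourier coefficients -/

/-- The box of integer frequencies `n` with `|n_i| ≤ 2 ^ (j + 1)` for all `i`. -/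
noncomputable def freqBox (d j : ℕ) : Finset (Fin d → ℤ) :=
  Fintype.piFinset fun _ => Finset.Icc (-(2 ^ (j + 1)) : ℤ) (2 ^ (j + 1))

theorem card_freqBox_le (d j : ℕ) : ((freqBox d j).card : ℝ) ≤ (8 * 2 ^ j) ^ d := by
  have h : (freqBox d j).card ≤ (8 * 2 ^ j) ^ d := by
    rw [freqBox, Fintype.card_piFinset]
    simp only [Int.card_Icc, Finset.prod_const, Finset.card_univ, Fintype.card_fin]
    refine Nat.pow_le_pow_left ?_ d
    have h1 : (1 : ℤ) ≤ 2 ^ j := one_le_pow₀ (by norm_num)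
    rw [Int.toNat_le]
    push_cast
    rw [pow_succ]
    linarith
  exact_mod_cast h

theorem norm_fourierCoeffDist_sq {d : ℕ} (u : PeriodicDistribution d) (n : Fin d → ℤ) :
    ‖fourierCoeffDist u n‖ ^ 2 = u (cosTest n) ^ 2 + u (sinTest n) ^ 2 := by
  rw [← Complex.normSq_eq_norm_sq, fourierCoeffDist, Complex.normSq_apply]
  simp
  ring

theorem norm_mFourier_apply {d : ℕ} (n : Fin d → ℤ) (r : UnitAddTorus (Fin d)) :
    ‖UnitAddTorus.mFourier n r‖ = 1 := by
  simp only [UnitAddTorus.mFourier, fourier_apply, ContinuousMap.coe_mk, norm_prod,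
    Circle.norm_coe, Finset.prod_const_one]

theorem cosTest_sq_add_sinTest_sq {d : ℕ} (n : Fin d → ℤ) (r : UnitAddTorus (Fin d)) :
    cosTest n r ^ 2 + sinTest n r ^ 2 = 1 := by
  have h2 : cosTest n r ^ 2 + sinTest n r ^ 2 = ‖UnitAddTorus.mFourier n r‖ ^ 2 := by
    rw [← Complex.normSq_eq_norm_sq, Complex.normSq_apply, ← sq, ← sq]
    rfl
  rw [h2, norm_mFourier_apply, one_pow]

theorem measureReal_two_le_sum_freqBox_le {Ω : Type*} [MeasurableSpace Ω] {P : Measure Ω}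
    [IsProbabilityMeasure P] {d : ℕ}
    {w : Ω → PeriodicDistribution d} (hw : Measurable w) {f : ℝ → ℂ} (hf : IsLevyExponent f)
    (hchar : ∀ φ : TestFunction d,
      charFunctional (P.map w) φ = Complex.exp (∫ r, f (φ r) ∂(torusMeasure d)))
    {δ C : ℝ} (hC : 0 ≤ C) (hfb : ∀ ξ, ‖f ξ‖ ≤ δ + C * ξ ^ 2) (c : ℕ → ℝ) (N : ℕ) :
    P.real {ω | 2 ≤ ∑ j ∈ Finset.range N, c j ^ 2 *
        ∑ n ∈ freqBox d j, ‖fourierCoeffDist (w ω) n‖ ^ 2}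
      ≤ 2 * (δ + C * ∑ j ∈ Finset.range N, c j ^ 2 * (8 * 2 ^ j) ^ d) := by
  -- One test function per level, frequency and parity. The boxes are nested, so a frequency recurs
  -- at several levels; this is harmless because only the pointwise sum of squares matters.
  let e : (Σ j : Fin N, ↥(freqBox d j) × Bool) → TestFunction d := fun k =>
    c k.1 • (bif k.2.2 then cosTest k.2.1 else sinTest k.2.1)
  have hsum : ∀ u v : (Fin d → ℤ) → ℝ,
      (∑ k : (Σ j : Fin N, ↥(freqBox d j) × Bool),
        (c k.1 * (bif k.2.2 then u k.2.1 else v k.2.1)) ^ 2)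
      = ∑ j ∈ Finset.range N, c j ^ 2 * ∑ n ∈ freqBox d j, (u n ^ 2 + v n ^ 2) := by
    intro u v
    rw [Fintype.sum_sigma, ← Fin.sum_univ_eq_sum_range (fun j => c j ^ 2 *
      ∑ n ∈ freqBox d j, (u n ^ 2 + v n ^ 2))]
    refine Finset.sum_congr rfl fun j _ => ?_
    rw [Fintype.sum_prod_type, ← Finset.sum_coe_sort (freqBox d j), Finset.mul_sum]
    refine Finset.sum_congr rfl fun n _ => ?_
    simp only [Fintype.sum_bool, cond_true, cond_false]
    ring
  have key := measureReal_two_le_sum_sq_testFunction_le hw hf hchar hC hfb e (fun k => ?_)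
    (A := ∑ j ∈ Finset.range N, c j ^ 2 * (8 * 2 ^ j) ^ d) fun r => ?_
  · refine le_trans (le_of_eq ?_) key
    congr 2
    ext ω
    have h1 : ∀ k, w ω (e k)
        = c k.1 * (bif k.2.2 then w ω (cosTest k.2.1) else w ω (sinTest k.2.1)) := by
      rintro ⟨j, n, b⟩
      cases b <;> simp [e]
    simp_rw [h1]
    rw [hsum (fun n => w ω (cosTest n)) (fun n => w ω (sinTest n))]
    simp_rw [norm_fourierCoeffDist_sq]
  · obtain ⟨j, n, b⟩ := k
    cases b
    · exact (continuous_sinTest _).const_smul (c j)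
    · exact (continuous_cosTest _).const_smul (c j)
  · have h1 : ∀ k, e k r
        = c k.1 * (bif k.2.2 then cosTest k.2.1 r else sinTest k.2.1 r) := by
      rintro ⟨j, n, b⟩
      cases b <;> rfl
    simp_rw [h1]
    rw [hsum (fun n => cosTest n r) (fun n => sinTest n r)]
    simp_rw [cosTest_sq_add_sinTest_sq]
    refine Finset.sum_le_sum fun j _ => mul_le_mul_of_nonneg_left ?_ (sq_nonneg _)
    simpa using card_freqBox_le d j

/-- The Fourier coefficients of a periodic Lévy white noise are almost surely square summable
with respect to the weights of the Sobolev space of order `s < -d / 2`. -/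
theorem ae_exists_sum_norm_fourierCoeffDist_sq_le {Ω : Type*} [MeasurableSpace Ω] {P : Measure Ω}
    [IsProbabilityMeasure P] {d : ℕ} {w : Ω → PeriodicDistribution d}
    (hw : IsPeriodicLevyWhiteNoise P w) {s : ℝ} (hs : s < -(d / 2 : ℝ)) :
    ∀ᵐ ω ∂P, ∃ K : ℝ, ∀ j : ℕ,
      ((2 : ℝ) ^ (j * s)) ^ 2 * ∑ n ∈ freqBox d j, ‖fourierCoeffDist (w ω) n‖ ^ 2 ≤ K := by
  obtain ⟨hwm, f, hf, hchar⟩ := hw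
  have hterm : ∀ j : ℕ, ((2 : ℝ) ^ (j * s)) ^ 2 * (8 * 2 ^ j) ^ d
      = 8 ^ d * ((2 : ℝ) ^ (2 * s + d)) ^ j := by
    intro j
    rw [mul_pow, ← pow_mul, ← Real.rpow_natCast ((2 : ℝ) ^ (j * s)), ← Real.rpow_mul two_pos.le,
      ← Real.rpow_natCast (2 : ℝ) (j * d), ← Real.rpow_natCast ((2 : ℝ) ^ (2 * s + d)) j,
      ← Real.rpow_mul two_pos.le, mul_left_comm, ← Real.rpow_add two_pos]
    congr 2
    push_cast
    ring
  -- The only place where `s < -d/2` enters: the weights beat the number of frequencies.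
  have hr : (2 : ℝ) ^ (2 * s + d) < 1 := Real.rpow_lt_one_of_one_lt_of_neg one_lt_two (by linarith)
  have hsummable : Summable fun j : ℕ => ((2 : ℝ) ^ (j * s)) ^ 2 * (8 * 2 ^ j) ^ d := by
    simp_rw [hterm]
    exact (summable_geometric_of_lt_one (by positivity) hr).mul_left _
  set A : ℝ := ∑' j : ℕ, ((2 : ℝ) ^ (j * s)) ^ 2 * (8 * 2 ^ j) ^ d with hAdef
  have hA0 : 0 ≤ A := tsum_nonneg fun j => by positivity
  rw [ae_iff]
  refine le_antisymm (ENNReal.le_of_forall_pos_le_add fun η hη _ => ?_) (zero_le)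
  rw [zero_add]
  have hη' : (0 : ℝ) < η := hη
  -- `C` depends on `δ = η/4`, so `t` is chosen afterwards to make `C t A ≤ η/4`; the probability
  -- bound is then `2 (η/4 + η/4) = η`. The `+ 1` in `t` keeps its denominator positive.
  obtain ⟨C, hC, hfb⟩ := hf.norm_le_add_mul_sq (δ := (η : ℝ) / 4) (by positivity)
  set t : ℝ := η / (4 * (C * A + 1)) with ht
  have hCA : 0 ≤ C * A := mul_nonneg hC hA0
  have ht0 : 0 < t := by positivity
  have htA : C * (t * A) ≤ η / 4 := by
    rw [ht, div_mul_eq_mul_div, mul_div_assoc', div_le_div_iff₀ (by positivity) (by norm_num)]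
    nlinarith
  set S : ℕ → Ω → ℝ := fun N ω => ∑ j ∈ Finset.range N, (√t * (2 : ℝ) ^ (j * s)) ^ 2 *
    ∑ n ∈ freqBox d j, ‖fourierCoeffDist (w ω) n‖ ^ 2 with hS
  have hSnn : ∀ (ω : Ω) (j : ℕ), 0 ≤ (√t * (2 : ℝ) ^ (j * s)) ^ 2 *
      ∑ n ∈ freqBox d j, ‖fourierCoeffDist (w ω) n‖ ^ 2 := fun ω j => by positivity
  have hmono : Monotone fun N => {ω | 2 ≤ S N ω} := by
    intro N N' hN ω hω
    exact le_trans hω (Finset.sum_le_sum_of_subset_of_nonneg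
      (Finset.range_mono hN) fun j _ _ => hSnn ω j)
  calc P {ω | ¬∃ K : ℝ, ∀ j : ℕ, ((2 : ℝ) ^ (j * s)) ^ 2 *
          ∑ n ∈ freqBox d j, ‖fourierCoeffDist (w ω) n‖ ^ 2 ≤ K}
      ≤ P (⋃ N, {ω | 2 ≤ S N ω}) := by
        -- If all partial sums stay below `2`, each single term does too, and `K = 2 / t` works.
        refine measure_mono fun ω hω => ?_
        by_contra hcon
        simp only [Set.mem_iUnion, Set.mem_ofPred_eq, not_exists, not_le] at hcon
        refine hω ⟨2 / t, fun j => ?_⟩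
        have h1 := (Finset.single_le_sum (f := fun j : ℕ => (√t * (2 : ℝ) ^ (j * s)) ^ 2 *
          ∑ n ∈ freqBox d j, ‖fourierCoeffDist (w ω) n‖ ^ 2) (fun j _ => hSnn ω j)
          (Finset.self_mem_range_succ j)).trans (hcon (j + 1)).le
        rw [mul_pow, Real.sq_sqrt ht0.le, mul_assoc] at h1
        rwa [le_div_iff₀' ht0]
    _ = ⨆ N, P {ω | 2 ≤ S N ω} := hmono.measure_iUnion
    _ ≤ η := by
        refine iSup_le fun N => ?_
        have h1 := measureReal_two_le_sum_freqBox_le (P := P) hwm hf hchar hC hfb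
          (fun j => √t * (2 : ℝ) ^ (j * s)) N
        have h2 : ∑ j ∈ Finset.range N, (√t * (2 : ℝ) ^ (j * s)) ^ 2 * (8 * 2 ^ j) ^ d ≤ t * A := by
          simp_rw [mul_pow √t, Real.sq_sqrt ht0.le, mul_assoc t]
          rw [← Finset.mul_sum]
          exact mul_le_mul_of_nonneg_left
            (hsummable.sum_le_tsum _ fun j _ => by positivity) ht0.le
        have h3 : P.real {ω | 2 ≤ S N ω} ≤ (η : ℝ) := by
          have h4 := mul_le_mul_of_nonneg_left h2 hC
          refine h1.trans ?_
          linarith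
        rw [← ofReal_measureReal, ← ENNReal.ofReal_coe_nnreal]
        exact ENNReal.ofReal_le_ofReal h3

/-! ### Dyadic blocks -/

theorem DyadicGenerator.exists_abs_piece_le {d : ℕ} (χ : DyadicGenerator d) :
    ∃ M : ℝ, 0 < M ∧ ∀ j x, |χ.piece j x| ≤ M := by
  obtain ⟨M, hM⟩ := (isCompact_closedBall (0 : EuclideanSpace ℝ (Fin d)) (3 / 2)).bddAbove_image
    χ.smooth.continuous.abs.continuousOn
  have h1 : ∀ x, |χ.toFun x| ≤ max M 1 := fun x => by
    obtain hx | hx := le_or_gt ‖x‖ (3 / 2)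
    · exact (hM ⟨x, by simpa using hx, rfl⟩).trans (le_max_left _ _)
    · rw [χ.eq_zero x hx.le, abs_zero]
      exact zero_le_one.trans (le_max_right _ _)
  have h2 : (0 : ℝ) < max M 1 := zero_lt_one.trans_le (le_max_right _ _)
  refine ⟨2 * max M 1, by positivity, fun j x => ?_⟩
  cases j with
  | zero => exact (h1 x).trans (by linarith)
  | succ j =>
    refine (abs_sub _ _).trans ?_
    linarith [h1 (((2 : ℝ) ^ (j + 1))⁻¹ • x), h1 (((2 : ℝ) ^ j)⁻¹ • x)]

theorem DyadicGenerator.piece_eq_zero {d : ℕ} (χ : DyadicGenerator d) {j : ℕ}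
    {x : EuclideanSpace ℝ (Fin d)} (hx : 3 / 2 * 2 ^ j ≤ ‖x‖) : χ.piece j x = 0 := by
  cases j with
  | zero => exact χ.eq_zero x (by simpa using hx)
  | succ j =>
    have h : ∀ k ≤ j + 1, χ.toFun (((2 : ℝ) ^ k)⁻¹ • x) = 0 := fun k hk => by
      refine χ.eq_zero _ ?_
      rw [norm_smul, norm_inv, norm_pow, Real.norm_two, le_inv_mul_iff₀ (by positivity)]
      refine le_trans ?_ hx
      rw [mul_comm]
      gcongr
      norm_num
    simp only [DyadicGenerator.piece]
    rw [h _ le_rfl, h _ (Nat.le_succ j), sub_zero]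

/-- Outside the box some coordinate exceeds `2 · 2^j`, hence so does the Euclidean norm, and the
piece lives in radius `3/2 · 2^j`. -/
theorem DyadicGenerator.piece_eq_zero_of_notMem_freqBox {d : ℕ} (χ : DyadicGenerator d) {j : ℕ}
    {n : Fin d → ℤ} (hn : n ∉ freqBox d j) :
    χ.piece j (WithLp.toLp 2 fun i => (n i : ℝ)) = 0 := by
  refine χ.piece_eq_zero ?_
  simp only [freqBox, Fintype.mem_piFinset, Finset.mem_Icc, not_forall, ← abs_le, not_le] at hn
  obtain ⟨i, hi⟩ := hn
  have h1 : (2 : ℝ) ^ (j + 1) < |(n i : ℝ)| := by exact_mod_cast hi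
  have h2 := PiLp.norm_apply_le (WithLp.toLp 2 fun i => (n i : ℝ) : EuclideanSpace ℝ (Fin d)) i
  simp only [Real.norm_eq_abs] at h2
  have h3 : (0 : ℝ) < 2 ^ j := by positivity
  rw [pow_succ] at h1
  linarith

theorem dyadicBlock_eq_sum {d : ℕ} (χ : DyadicGenerator d) (u : PeriodicDistribution d) (j : ℕ)
    (x : UnitAddTorus (Fin d)) :
    dyadicBlock χ u j x = ∑ n ∈ freqBox d j,
      ((χ.piece j (WithLp.toLp 2 fun i => (n i : ℝ)) : ℝ) : ℂ) *
        fourierCoeffDist u n * UnitAddTorus.mFourier n x :=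
  tsum_eq_sum fun n hn => by rw [χ.piece_eq_zero_of_notMem_freqBox hn]; simp

/-- **Parseval's identity** for trigonometric polynomials. -/
theorem eLpNorm_two_sum_mFourier {d : ℕ} (s : Finset (Fin d → ℤ)) (c : (Fin d → ℤ) → ℂ) :
    eLpNorm (fun x => ∑ n ∈ s, c n * UnitAddTorus.mFourier n x) 2 (torusMeasure d)
      = ENNReal.ofReal √(∑ n ∈ s, ‖c n‖ ^ 2) := by
  have horth : Orthonormal ℂ fun n : Fin d → ℤ =>
      ContinuousMap.toLp (E := ℂ) 2 (torusMeasure d) ℂ (UnitAddTorus.mFourier n) :=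
    UnitAddTorus.orthonormal_mFourier
  set G : C(UnitAddTorus (Fin d), ℂ) := ∑ n ∈ s, c n • UnitAddTorus.mFourier n with hG
  have hGx : (fun x => ∑ n ∈ s, c n * UnitAddTorus.mFourier n x) = G := by
    ext x
    simp [hG, ContinuousMap.sum_apply]
  have hsum : ContinuousMap.toLp (E := ℂ) 2 (torusMeasure d) ℂ G = ∑ n ∈ s, c n •
      ContinuousMap.toLp (E := ℂ) 2 (torusMeasure d) ℂ (UnitAddTorus.mFourier n) := by
    rw [hG, map_sum]
    simp_rw [map_smul]
  have hnorm : ‖ContinuousMap.toLp (E := ℂ) 2 (torusMeasure d) ℂ G‖ ^ 2 = ∑ n ∈ s, ‖c n‖ ^ 2 := by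
    have h := horth.inner_sum c c s
    rw [← hsum, inner_self_eq_norm_sq_to_K] at h
    have h2 : ∀ n, (starRingEnd ℂ) (c n) * c n = ((‖c n‖ ^ 2 : ℝ) : ℂ) := fun n => by
      rw [Complex.conj_mul', Complex.ofReal_pow]
    simp_rw [h2] at h
    apply Complex.ofReal_injective
    exact (Complex.ofReal_pow _ _).trans (h.trans (Complex.ofReal_sum _ _).symm)
  rw [hGx, ← eLpNorm_congr_ae (ContinuousMap.coeFn_toLp (E := ℂ) (p := 2) (𝕜 := ℂ)
    (torusMeasure d) G), ← Lp.enorm_def, ← hnorm, Real.sqrt_sq (norm_nonneg _), ofReal_norm]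

theorem eLpNorm_two_dyadicBlock_le {d : ℕ} {χ : DyadicGenerator d} {M : ℝ} (hM : 0 ≤ M)
    (hχ : ∀ j x, |χ.piece j x| ≤ M) (u : PeriodicDistribution d) (j : ℕ) :
    eLpNorm (dyadicBlock χ u j) 2 (torusMeasure d)
      ≤ ENNReal.ofReal (M * √(∑ n ∈ freqBox d j, ‖fourierCoeffDist u n‖ ^ 2)) := by
  rw [funext (dyadicBlock_eq_sum χ u j), eLpNorm_two_sum_mFourier]
  refine ENNReal.ofReal_le_ofReal (Real.sqrt_le_iff.2 ⟨by positivity, ?_⟩)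
  rw [mul_pow, Real.sq_sqrt (by positivity), Finset.mul_sum]
  refine Finset.sum_le_sum fun n _ => ?_
  rw [norm_mul, mul_pow, Complex.norm_real]
  have := hχ j (WithLp.toLp 2 fun i => (n i : ℝ))
  gcongr
  exact this

/-- A Bernstein-type inequality: Cauchy–Schwarz over the `O(2^{jd})` frequencies of the box bounds
the supremum at the cost of a factor `O(2^{jd/2})`. -/
theorem norm_dyadicBlock_le {d : ℕ} {χ : DyadicGenerator d} {M : ℝ} (hM : 0 ≤ M)
    (hχ : ∀ j x, |χ.piece j x| ≤ M) (u : PeriodicDistribution d) (j : ℕ)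
    (x : UnitAddTorus (Fin d)) :
    ‖dyadicBlock χ u j x‖
      ≤ √((8 * 2 ^ j) ^ d) * (M * √(∑ n ∈ freqBox d j, ‖fourierCoeffDist u n‖ ^ 2)) := by
  have h1 : ∑ n ∈ freqBox d j, ‖fourierCoeffDist u n‖
      ≤ √((8 * 2 ^ j) ^ d) * √(∑ n ∈ freqBox d j, ‖fourierCoeffDist u n‖ ^ 2) := by
    rw [← Real.sqrt_mul (by positivity)]
    refine Real.le_sqrt_of_sq_le (sq_sum_le_card_mul_sum_sq.trans ?_)
    gcongr
    exact card_freqBox_le d j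
  calc ‖dyadicBlock χ u j x‖ ≤ ∑ n ∈ freqBox d j, M * ‖fourierCoeffDist u n‖ := by
        rw [dyadicBlock_eq_sum]
        refine norm_sum_le_of_le _ fun n _ => ?_
        rw [norm_mul, norm_mul, norm_mFourier_apply, mul_one, Complex.norm_real]
        exact mul_le_mul_of_nonneg_right (hχ j _) (norm_nonneg _)
    _ ≤ M * (√((8 * 2 ^ j) ^ d) * √(∑ n ∈ freqBox d j, ‖fourierCoeffDist u n‖ ^ 2)) := by
        rw [← Finset.mul_sum]
        exact mul_le_mul_of_nonneg_left h1 hM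
    _ = _ := by ring

theorem continuous_dyadicBlock {d : ℕ} (χ : DyadicGenerator d) (u : PeriodicDistribution d)
    (j : ℕ) : Continuous (dyadicBlock χ u j) := by
  rw [funext (dyadicBlock_eq_sum χ u j)]
  fun_prop

/-! ### Interpolation and the Besov norm -/

/-- Interpolation of the `L_p` norm between `L_2` and `L_∞` if `p ≥ 2`, and its monotonicity in `p`
on probability spaces if `p ≤ 2`. -/
theorem eLpNorm_le_ofReal_rpow_mul_rpow {α : Type*} [MeasurableSpace α] {μ : Measure α}
    [IsProbabilityMeasure μ] {u : α → ℂ} (hu : AEStronglyMeasurable u μ) {B N : ℝ} (hB : 0 ≤ B)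
    (hN : 0 ≤ N) (huB : ∀ x, ‖u x‖ ≤ B) (huN : eLpNorm u 2 μ ≤ ENNReal.ofReal N) (p : ℝ≥0∞) :
    eLpNorm u p μ ≤ ENNReal.ofReal
      (B ^ (1 - 2 * (1 / max p 2).toReal) * N ^ (2 * (1 / max p 2).toReal)) := by
  obtain hp | hp := le_or_gt p 2
  · rw [max_eq_right hp]
    have h : (1 / (2 : ℝ≥0∞)).toReal = 1 / 2 := by simp
    rw [h]
    norm_num
    exact (eLpNorm_le_eLpNorm_of_exponent_le hp hu).trans huN
  · rw [max_eq_left hp.le]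
    obtain rfl | hpt := eq_or_ne p ⊤
    · simp only [ENNReal.div_top, ENNReal.toReal_zero, mul_zero, sub_zero, Real.rpow_one,
        Real.rpow_zero, mul_one, eLpNorm_exponent_top]
      exact eLpNormEssSup_le_of_ae_bound (ae_of_all _ huB)
    · set r : ℝ := p.toReal with hr
      have hr2 : 2 < r := by
        have := (ENNReal.toReal_lt_toReal (by simp) hpt).2 hp
        simpa using this
      have hp0 : p ≠ 0 := (lt_trans (by norm_num) hp).ne'
      have hinv : (1 / p).toReal = 1 / r := by simp [hr]
      -- Integrating this and taking the power `1/r` gives the exponents `(r - 2)/r = 1 - 2/r` and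
      -- `2/r`.
      have hpoint : ∀ x, ‖u x‖ₑ ^ r ≤ ENNReal.ofReal B ^ (r - 2) * ‖u x‖ₑ ^ (2 : ℝ) := fun x => by
        have h1 : ‖u x‖ₑ ^ r = ‖u x‖ₑ ^ (r - 2) * ‖u x‖ₑ ^ (2 : ℝ) := by
          rw [← ENNReal.rpow_add_of_nonneg _ _ (by linarith) (by norm_num), sub_add_cancel]
        rw [h1]
        gcongr
        rw [← ofReal_norm]
        exact ENNReal.ofReal_le_ofReal (huB x)
      have h2 : ∫⁻ x, ‖u x‖ₑ ^ (2 : ℝ) ∂μ ≤ ENNReal.ofReal N ^ (2 : ℝ) := by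
        rw [eLpNorm_eq_lintegral_rpow_enorm_toReal (by norm_num) (by norm_num)] at huN
        have h3 := ENNReal.rpow_le_rpow huN (zero_le_two (α := ℝ))
        rw [← ENNReal.rpow_mul] at h3
        simpa using h3
      rw [eLpNorm_eq_lintegral_rpow_enorm_toReal hp0 hpt, hinv]
      calc (∫⁻ x, ‖u x‖ₑ ^ r ∂μ) ^ (1 / r)
          ≤ (ENNReal.ofReal B ^ (r - 2) * ENNReal.ofReal N ^ (2 : ℝ)) ^ (1 / r) := by
            refine ENNReal.rpow_le_rpow ?_ (by positivity)
            refine (lintegral_mono hpoint).trans ?_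
            rw [lintegral_const_mul' _ _ (ENNReal.rpow_ne_top_of_nonneg (by linarith)
              ENNReal.ofReal_ne_top)]
            gcongr
        _ = _ := by
            rw [ENNReal.ofReal_rpow_of_nonneg hB (by linarith),
              ENNReal.ofReal_rpow_of_nonneg hN (by norm_num),
              ← ENNReal.ofReal_mul (by positivity),
              ENNReal.ofReal_rpow_of_nonneg (by positivity) (by positivity),
              Real.mul_rpow (by positivity) (by positivity), ← Real.rpow_mul hB,
              ← Real.rpow_mul hN]
            congr 3
            field_simp

/-- Geometric decay makes the index `q` irrelevant: the `q`-th powers are again dominated by a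
geometric series, of ratio `ρ^q < 1`. -/
theorem besovNorm_lt_top_of_le_geometric {d : ℕ} {χ : DyadicGenerator d} {τ : ℝ} {p q : ℝ≥0∞}
    (hq : 0 < q) {u : PeriodicDistribution d} {D ρ : ℝ} (hD : 0 ≤ D) (hρ0 : 0 ≤ ρ) (hρ1 : ρ < 1)
    (h : ∀ j : ℕ, (2 : ℝ≥0∞) ^ ((j : ℝ) * τ) * eLpNorm (dyadicBlock χ u j) p (torusMeasure d)
      ≤ ENNReal.ofReal (D * ρ ^ j)) : besovNorm χ τ p q u < ⊤ := by
  unfold besovNorm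
  split_ifs with hqt
  · refine (iSup_le fun j => (h j).trans (ENNReal.ofReal_le_ofReal
      (mul_le_of_le_one_right hD (pow_le_one₀ hρ0 hρ1.le)))).trans_lt ENNReal.ofReal_lt_top
  · have hq0 : 0 < q.toReal := ENNReal.toReal_pos hq.ne' hqt
    refine ENNReal.rpow_lt_top_of_nonneg (by positivity) (ne_top_of_le_ne_top ?_
      (ENNReal.tsum_le_tsum fun j => ENNReal.rpow_le_rpow (h j) hq0.le))
    have h1 : ∀ j : ℕ, ENNReal.ofReal (D * ρ ^ j) ^ q.toReal
        = ENNReal.ofReal (D ^ q.toReal * (ρ ^ q.toReal) ^ j) := fun j => by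
      rw [ENNReal.ofReal_rpow_of_nonneg (by positivity) hq0.le, Real.mul_rpow hD (by positivity),
        Real.rpow_pow_comm hρ0]
    simp_rw [h1]
    exact ((summable_geometric_of_lt_one (by positivity)
      (Real.rpow_lt_one hρ0 hρ1 hq0)).mul_left _).tsum_ofReal_ne_top

/-- A Sobolev-type embedding: blocks are `O(2^{-js})` in `L_2` and `O(2^{j(d/2 - s)})` in `L_∞`,
hence `O(2^{j(a - s)})` in `L_p` with `a = d (1/2 - 1/max(p,2))`. The hypothesis on `τ` says `τ - s
+ a < 0`. -/
theorem mem_besovSpace_of_sum_norm_fourierCoeffDist_sq_le {d : ℕ} {u : PeriodicDistribution d}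
    {s K : ℝ} (hK : ∀ j : ℕ,
      ((2 : ℝ) ^ (j * s)) ^ 2 * ∑ n ∈ freqBox d j, ‖fourierCoeffDist u n‖ ^ 2 ≤ K)
    {p q : ℝ≥0∞} (hq : 0 < q) {τ : ℝ}
    (hτ : τ + d * (1 / 2 - (1 / max p 2).toReal) < s) : u ∈ besovSpace d τ p q := by
  intro χ
  obtain ⟨M, hM, hχ⟩ := χ.exists_abs_piece_le
  -- Replacing `K` by `max K 1` makes `Y j` strictly positive, as needed to add its real exponents.
  have hK' : 0 < max K 1 := zero_lt_one.trans_le (le_max_right _ _)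
  set θ : ℝ := (1 / max p 2).toReal with hθ
  set L : ℝ := M * √(max K 1) with hL
  have hL0 : 0 < L := by positivity
  set Y : ℕ → ℝ := fun j => L * (2 : ℝ) ^ (-(j * s)) with hY
  have hY0 : ∀ j, 0 < Y j := fun j => by positivity
  have hT : ∀ j, M * √(∑ n ∈ freqBox d j, ‖fourierCoeffDist u n‖ ^ 2) ≤ Y j := fun j => by
    rw [hY, hL]
    simp only
    rw [mul_assoc]
    refine mul_le_mul_of_nonneg_left (Real.sqrt_le_iff.2 ⟨by positivity, ?_⟩) hM.le
    rw [mul_pow, Real.sq_sqrt hK'.le, Real.rpow_neg two_pos.le, inv_pow, ← div_eq_mul_inv,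
      le_div_iff₀' (by positivity)]
    exact (hK j).trans (le_max_left _ _)
  set a : ℝ := d / 2 * (1 - 2 * θ) with ha
  refine besovNorm_lt_top_of_le_geometric hq (D := L * 8 ^ a) (ρ := 2 ^ (τ - s + a))
    (by positivity) (by positivity)
    (Real.rpow_lt_one_of_one_lt_of_neg one_lt_two (by rw [ha]; linarith)) fun j => ?_
  have h1 := eLpNorm_le_ofReal_rpow_mul_rpow (μ := torusMeasure d)
    (continuous_dyadicBlock χ u j).aestronglyMeasurable
    (B := √((8 * 2 ^ j) ^ d) * Y j) (N := Y j) (by positivity) (hY0 j).le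
    (fun x => (norm_dyadicBlock_le hM.le hχ u j x).trans
      (mul_le_mul_of_nonneg_left (hT j) (Real.sqrt_nonneg _)))
    ((eLpNorm_two_dyadicBlock_le hM.le hχ u j).trans (ENNReal.ofReal_le_ofReal (hT j))) p
  rw [← hθ] at h1
  have h2 : (√((8 * 2 ^ j) ^ d) * Y j) ^ (1 - 2 * θ) * Y j ^ (2 * θ)
      = L * 8 ^ a * 2 ^ (j * (a - s)) := by
    rw [Real.mul_rpow (by positivity) (hY0 j).le, mul_assoc, ← Real.rpow_add (hY0 j),
      sub_add_cancel, Real.rpow_one, Real.sqrt_eq_rpow, ← Real.rpow_natCast (8 * 2 ^ j) d,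
      ← Real.rpow_mul (by positivity), ← Real.rpow_mul (by positivity),
      show (d : ℝ) * (1 / 2 * (1 - 2 * θ)) = a by rw [ha]; ring,
      Real.mul_rpow (by norm_num) (by positivity), ← Real.rpow_natCast 2 j,
      ← Real.rpow_mul two_pos.le, hY, show (j : ℝ) * (a - s) = j * a + -(j * s) by ring,
      Real.rpow_add two_pos]
    ring
  have h3 : (2 : ℝ≥0∞) ^ ((j : ℝ) * τ) = ENNReal.ofReal ((2 : ℝ) ^ ((j : ℝ) * τ)) := by
    rw [← ENNReal.ofReal_rpow_of_pos two_pos]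
    norm_num
  rw [h3]
  refine (mul_le_mul_right h1 _).trans_eq ?_
  rw [h2, ← ENNReal.ofReal_mul (by positivity)]
  congr 1
  rw [← Real.rpow_natCast (2 ^ (τ - s + a)) j, ← Real.rpow_mul two_pos.le,
    show (τ - s + a) * (j : ℝ) = j * τ + j * (a - s) by ring, Real.rpow_add two_pos]
  ring

end PeriodicNoise

theorem corollary4p2 {Ω : Type*} [MeasurableSpace Ω] (P : Measure Ω) [IsProbabilityMeasure P]
    (d : ℕ) (w : Ω → PeriodicNoise.PeriodicDistribution d)
    (hw : PeriodicNoise.IsPeriodicLevyWhiteNoise P w)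
    (p q : ℝ≥0∞) (hp : 0 < p) (hq : 0 < q) (τ : ℝ)
    (hτ : τ < (d : ℝ) * ((1 / max p 2).toReal - 1)) :
    ∀ᵐ ω ∂P, w ω ∈ PeriodicNoise.besovSpace d τ p q := by
  -- The assumption on `τ` is exactly that a Sobolev order `s < -d/2` remains after paying the
  -- embedding loss.
  obtain ⟨s, hs1, hs2⟩ := exists_between (show
    τ + d * (1 / 2 - (1 / max p 2).toReal) < -(d / 2 : ℝ) by linarith)
  filter_upwards [PeriodicNoise.ae_exists_sum_norm_fourierCoeffDist_sq_le hw hs2] with ω hω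
  obtain ⟨K, hK⟩ := hω
  exact PeriodicNoise.mem_besovSpace_of_sum_norm_fourierCoeffDist_sq_le hK hq hs1
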